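/- Let $n\ge 2$ and let $w\in\mathfrak S_n$ be a permutation with $\{w(1),\dots,w(r)\}\ne\{1,\dots,r\}$ for all $1\le r<n$. Let $X(w)$ be Elnitsky's polygon of $w$: the equilateral $2n$-gon whose sides are labeled $1,\dots,n,w(n),\dots,w(1)$ in counterclockwise order starting from the top vertex, such that the first $n$ sides (the leftside boundary) form half of a convex $2n$-gon and sides with the same label are parallel; the sides $w(1),\dots,w(n)$, read from the top vertex to the bottom vertex, form the rightside boundary. A rhombic tiling of $X(w)$ is a tiling by rhombi whose edges are congruent and parallel to sides of $X(w)$; the tile $\{x,y\}$ is the one whose edges are parallel to the sides labeled $x$ and $y$. A tile is a right- (left-) perimeter tile if it shares two consecutive edges with the rightside (leftside) boundary, and a top- (bottom-) perimeter tile if the two sides of $X(w)$ meeting in the top (bottom) vertex are edges of it. A tile is a forced right- (left-, top-, bottom-) perimeter tile for $w$ if it appears in every rhombic tiling of $X(w)$ as a right- (left-, top-, bottom-) perimeter tile. Then: 1. if there is a forced right-perimeter tile $\{w(1),w(2)\}$, then this tile is a forced top-perimeter tile, too; 2. if there is a forced left-perimeter tile $\{1,2\}$, then this tile is a forced top-perimeter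 tile, too; 3. if there is a forced right-perimeter tile $\{w(n-1),w(n)\}$, then this tile is a forced bottom-perimeter tile, too; 4. if there is a forced left-perimeter tile $\{n-1,n\}$, then this tile is a forced bottom-perimeter tile, too. -/

import Mathlib

open Set

noncomputable section

namespace Elnitsky

/-- Labels `1, …, n` are represented by `Fin n` (so the label `k` is the element `k - 1`).
A sequence of angles is admissible if the unit vectors with these angles, put end to end, form
half of a convex (equilateral) `2n`-gon, drawn as the leftside boundary from top to bottom,
traversed counterclockwise: the directions turn strictly counterclockwise and all point downwards. -/
def Admissible {n : ℕ} (θ : Fin n → ℝ) : Prop :=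
  StrictMono θ ∧ ∀ i, θ i ∈ Ioo Real.pi (2 * Real.pi)

/-- The (unit) edge vector of the sides labeled `i`, directed downwards. -/
def edgeVec {n : ℕ} (θ : Fin n → ℝ) (i : Fin n) : ℂ :=
  Complex.exp ((θ i : ℂ) * Complex.I)

/-- The `k`-th vertex (`k = 0, …, n`) of the path that starts in the top vertex `0` and whose
successive sides are labeled `u 0, u 1, …, u (n-1)` from top to bottom. -/
def vertex {n : ℕ} (θ : Fin n → ℝ) (u : Equiv.Perm (Fin n)) (k : ℕ) : ℂ :=
  ∑ i : Fin n with i.val < k, edgeVec θ (u i)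

/-- The side of this path that joins its `k`-th vertex to the next; its label is `u k`. -/
def pathSide {n : ℕ} (θ : Fin n → ℝ) (u : Equiv.Perm (Fin n)) (k : Fin n) : Set ℂ :=
  segment ℝ (vertex θ u k.val) (vertex θ u (k.val + 1))

/-- The `k`-th side from the top of the leftside boundary (label `k`). -/
def leftSide {n : ℕ} (θ : Fin n → ℝ) (k : Fin n) : Set ℂ := pathSide θ 1 k

/-- The `k`-th side from the top of the rightside boundary of `X(w)` (label `w k`). -/
def rightSide {n : ℕ} (θ : Fin n → ℝ) (w : Equiv.Perm (Fin n)) (k : Fin n) : Set ℂ :=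
  pathSide θ w k

def leftBoundary {n : ℕ} (θ : Fin n → ℝ) : Set ℂ := ⋃ k, leftSide θ k

def rightBoundary {n : ℕ} (θ : Fin n → ℝ) (w : Equiv.Perm (Fin n)) : Set ℂ :=
  ⋃ k, rightSide θ w k

/-- Elnitsky's polygon `X(w)` as a closed region of the plane. All sides are directed strictly
downwards, so each boundary path meets each horizontal line between top and bottom in one point;
the region consists of the horizontal segments from the leftside to the rightside boundary. -/
def polygon {n : ℕ} (θ : Fin n → ℝ) (w : Equiv.Perm (Fin n)) : Set ℂ :=
  {p | ∃ l ∈ leftBoundary θ, ∃ r ∈ rightBoundary θ w,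
    l.im = p.im ∧ r.im = p.im ∧ l.re ≤ p.re ∧ p.re ≤ r.re}

/-- A rhombic tile whose edges are congruent and parallel to sides of the polygon: it is given by
its top vertex and its two labels. -/
structure Tile (n : ℕ) where
  top : ℂ
  lo : Fin n
  hi : Fin n
  lo_lt_hi : lo < hi

namespace Tile

variable {n : ℕ}

/-- The set of the two labels of a tile. -/
def labels (t : Tile n) : Finset (Fin n) := {t.lo, t.hi}

/-- The closed rhombus that the tile occupies. -/
def carrier (θ : Fin n → ℝ) (t : Tile n) : Set ℂ :=
  {z | ∃ a ∈ Icc (0 : ℝ) 1, ∃ b ∈ Icc (0 : ℝ) 1,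
    z = t.top + (a : ℂ) * edgeVec θ t.lo + (b : ℂ) * edgeVec θ t.hi}

/-- The four edges of the tile. -/
def edges (θ : Fin n → ℝ) (t : Tile n) : Set (Set ℂ) :=
  {segment ℝ t.top (t.top + edgeVec θ t.lo),
   segment ℝ t.top (t.top + edgeVec θ t.hi),
   segment ℝ (t.top + edgeVec θ t.lo) (t.top + edgeVec θ t.lo + edgeVec θ t.hi),
   segment ℝ (t.top + edgeVec θ t.hi) (t.top + edgeVec θ t.lo + edgeVec θ t.hi)}

end Tile

/-- `T` is a rhombic tiling of `X(w)`: its tiles cover exactly the polygon, and distinct tiles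
have disjoint interiors. -/
def IsRhombicTiling {n : ℕ} (θ : Fin n → ℝ) (w : Equiv.Perm (Fin n)) (T : Finset (Tile n)) :
    Prop :=
  (⋃ t ∈ T, t.carrier θ) = polygon θ w ∧
    (T : Set (Tile n)).Pairwise fun s t =>
      Disjoint (interior (s.carrier θ)) (interior (t.carrier θ))

/-- The tile shares two consecutive edges with the leftside boundary. -/
def IsLeftPerimeter {n : ℕ} (θ : Fin n → ℝ) (t : Tile n) : Prop :=
  ∃ j k : Fin n, k.val = j.val + 1 ∧ leftSide θ j ∈ t.edges θ ∧ leftSide θ k ∈ t.edges θ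

/-- The tile shares two consecutive edges with the rightside boundary. -/
def IsRightPerimeter {n : ℕ} (θ : Fin n → ℝ) (w : Equiv.Perm (Fin n)) (t : Tile n) : Prop :=
  ∃ j k : Fin n, k.val = j.val + 1 ∧ rightSide θ w j ∈ t.edges θ ∧ rightSide θ w k ∈ t.edges θ

/-- The tile has as edges the two sides of `X(w)` that meet in the top vertex. -/
def IsTopPerimeter {n : ℕ} (θ : Fin n → ℝ) (w : Equiv.Perm (Fin n)) (t : Tile n) : Prop :=
  ∃ k : Fin n, k.val = 0 ∧ leftSide θ k ∈ t.edges θ ∧ rightSide θ w k ∈ t.edges θ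

/-- The tile has as edges the two sides of `X(w)` that meet in the bottom vertex. -/
def IsBottomPerimeter {n : ℕ} (θ : Fin n → ℝ) (w : Equiv.Perm (Fin n)) (t : Tile n) : Prop :=
  ∃ k : Fin n, k.val + 1 = n ∧ leftSide θ k ∈ t.edges θ ∧ rightSide θ w k ∈ t.edges θ

/-- The tile `t` appears in all rhombic tilings of `X(w)` as a left-perimeter tile. -/
def IsForcedLeft {n : ℕ} (θ : Fin n → ℝ) (w : Equiv.Perm (Fin n)) (t : Tile n) : Prop :=
  ∀ T, IsRhombicTiling θ w T → t ∈ T ∧ IsLeftPerimeter θ t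

/-- The tile `t` appears in all rhombic tilings of `X(w)` as a right-perimeter tile. -/
def IsForcedRight {n : ℕ} (θ : Fin n → ℝ) (w : Equiv.Perm (Fin n)) (t : Tile n) : Prop :=
  ∀ T, IsRhombicTiling θ w T → t ∈ T ∧ IsRightPerimeter θ w t

/-- The tile `t` appears in all rhombic tilings of `X(w)` as a top-perimeter tile. -/
def IsForcedTop {n : ℕ} (θ : Fin n → ℝ) (w : Equiv.Perm (Fin n)) (t : Tile n) : Prop :=
  ∀ T, IsRhombicTiling θ w T → t ∈ T ∧ IsTopPerimeter θ w t

/-- The tile `t` appears in all rhombic tilings of `X(w)` as a bottom-perimeter tile. -/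
def IsForcedBottom {n : ℕ} (θ : Fin n → ℝ) (w : Equiv.Perm (Fin n)) (t : Tile n) : Prop :=
  ∀ T, IsRhombicTiling θ w T → t ∈ T ∧ IsBottomPerimeter θ w t

/-- `{w(1), …, w(r)} ≠ {1, …, r}` for all `0 < r < n`. -/
def FullySupported {n : ℕ} (w : Equiv.Perm (Fin n)) : Prop :=
  ∀ r : ℕ, 0 < r → r < n → w '' {i | i.val < r} ≠ {i | i.val < r}

end Elnitsky

end

/-!
A tile of `X(w)` that contains the top vertex of `X(w)` must be the tile `{1, w(1)}` as soon as the
latter occurs in the tiling: near the top vertex `X(w)` is covered by `{1, w(1)}` alone, while every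
tile is the closure of its interior. So it is enough to exhibit one tiling containing `{1, w(1)}`.
Tilings are grown along the weak order: exchanging two adjacent labels of the right boundary that
are in increasing order enlarges the polygon by one rhombus. Going down from `w`, move the label `1`
to the front by adjacent exchanges; the last of them, with the label `w(1)`, is the required
rhombus. The bottom vertex is handled in the same way, moving the label `n` to the end.
-/

namespace Elnitsky

open Filter Topology

section Parallelogram

/-- The determinant of two plane vectors. It is positive if the second vector points to the left of
the first one. -/
def cross (a b : ℂ) : ℝ := a.re * b.im - a.im * b.re

/-- The closed parallelogram with vertex `p` spanned by `a` and `b`; the carrier of a tile is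
definitionally of this form. -/
def parallelogram (p a b : ℂ) : Set ℂ :=
  {z | ∃ s ∈ Icc (0 : ℝ) 1, ∃ t ∈ Icc (0 : ℝ) 1, z = p + (s : ℂ) * a + (t : ℂ) * b}

variable {p a b z : ℂ}

theorem mem_segment_add : z ∈ segment ℝ p (p + a) ↔ ∃ s ∈ Icc (0 : ℝ) 1, z = p + (s : ℂ) * a := by
  rw [segment_eq_image']
  simp [eq_comm]

theorem segment_add_inj {q : ℂ} (ha : a.im < 0) (hb : b.im < 0)
    (h : segment ℝ p (p + a) = segment ℝ q (q + b)) : p = q ∧ a = b := by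
  obtain ⟨s, hs, hps⟩ := mem_segment_add.1 (h ▸ left_mem_segment ℝ p (p + a))
  obtain ⟨t, ht, hqt⟩ := mem_segment_add.1 (h ▸ left_mem_segment ℝ q (q + b))
  obtain rfl : p = q := by
    have hp := congrArg Complex.im hps
    have hq := congrArg Complex.im hqt
    simp only [Complex.add_im, Complex.im_ofReal_mul] at hp hq
    have hsb := mul_nonpos_of_nonneg_of_nonpos hs.1 hb.le
    have hta := mul_nonpos_of_nonneg_of_nonpos ht.1 ha.le
    have hs0 : s = 0 := (mul_eq_zero.1 (show s * b.im = 0 by linarith)).resolve_right hb.ne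
    simpa [hs0] using hps
  obtain ⟨s, hs, has⟩ := mem_segment_add.1 (h ▸ right_mem_segment ℝ p (p + a))
  obtain ⟨t, ht, hbt⟩ := mem_segment_add.1 (h ▸ right_mem_segment ℝ p (p + b))
  rw [add_right_inj] at has hbt
  have ha' := congrArg Complex.im has
  have hb' := congrArg Complex.im hbt
  rw [Complex.im_ofReal_mul] at ha' hb'
  have hs1 : s = 1 := by nlinarith [hs.2, ht.2]
  exact ⟨rfl, by simpa [hs1] using has⟩

theorem parallelogram_comm (p a b : ℂ) : parallelogram p a b = parallelogram p b a := by
  ext z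
  constructor <;> rintro ⟨s, hs, t, ht, rfl⟩ <;> exact ⟨t, ht, s, hs, by ring⟩

theorem segment_subset_parallelogram : segment ℝ p (p + a) ⊆ parallelogram p a b := by
  intro z hz
  obtain ⟨s, hs, rfl⟩ := mem_segment_add.1 hz
  exact ⟨s, hs, 0, by simp, by simp⟩

theorem segment_add_subset_parallelogram :
    segment ℝ (p + a) (p + a + b) ⊆ parallelogram p a b := by
  intro z hz
  obtain ⟨s, hs, rfl⟩ := mem_segment_add.1 hz
  exact ⟨1, by simp, s, hs, by simp⟩

theorem convex_parallelogram (p a b : ℂ) : Convex ℝ (parallelogram p a b) := by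
  rintro _ ⟨s, hs, t, ht, rfl⟩ _ ⟨s', hs', t', ht', rfl⟩ x y hx hy hxy
  refine ⟨x * s + y * s', convex_Icc (0 : ℝ) 1 hs hs' hx hy hxy,
    x * t + y * t', convex_Icc (0 : ℝ) 1 ht ht' hx hy hxy, ?_⟩
  have hxy' : (x : ℂ) + y = 1 := by exact_mod_cast hxy
  simp only [Complex.real_smul]
  push_cast
  linear_combination p * hxy'

theorem eq_add_of_cross_ne_zero (hab : cross a b ≠ 0) (z : ℂ) :
    z = (cross z b / cross a b) • a + (cross a z / cross a b) • b := by
  apply Complex.ext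
  · simp only [Complex.add_re, Complex.real_smul, Complex.re_ofReal_mul]
    field_simp
    simp only [cross]
    ring
  · simp only [Complex.add_im, Complex.real_smul, Complex.im_ofReal_mul]
    field_simp
    simp only [cross]
    ring

theorem nonempty_interior_parallelogram (p : ℂ) (hab : cross a b ≠ 0) :
    (interior (parallelogram p a b)).Nonempty := by
  let f : ℝ × ℝ →ₗ[ℝ] ℂ :=
    (LinearMap.toSpanSingleton ℝ ℂ a).coprod (LinearMap.toSpanSingleton ℝ ℂ b)
  have hf : Function.Surjective f := fun z => ⟨(_, _), (eq_add_of_cross_ne_zero hab z).symm⟩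
  have hopen : IsOpenMap fun x => p + f x :=
    (isOpenMap_add_left p).comp (f.isOpenMap_of_finiteDimensional hf)
  have hsub : (fun x => p + f x) '' Ioo 0 1 ×ˢ Ioo 0 1 ⊆ parallelogram p a b := by
    rintro _ ⟨⟨s, t⟩, ⟨hs, ht⟩, rfl⟩
    exact ⟨s, Ioo_subset_Icc_self hs, t, Ioo_subset_Icc_self ht, by simp [f, add_assoc]⟩
  exact (((nonempty_Ioo.2 one_pos).prod (nonempty_Ioo.2 one_pos)).image _).mono
    (interior_maximal hsub (hopen _ (isOpen_Ioo.prod isOpen_Ioo)))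

theorem parallelogram_subset_closure_interior (p : ℂ) (hab : cross a b ≠ 0) :
    parallelogram p a b ⊆ closure (interior (parallelogram p a b)) := by
  rw [(convex_parallelogram p a b).closure_interior_eq_closure_of_nonempty_interior
    (nonempty_interior_parallelogram p hab)]
  exact subset_closure

theorem exists_nonneg_add_mul_eq_one_or_sub_mul_eq_zero {s t α β : ℝ} (hs : s ≤ 1) (ht : 0 ≤ t)
    (hα : 0 < α) (hβ : 0 < β) :
    ∃ c, 0 ≤ c ∧ s + c * β ≤ 1 ∧ 0 ≤ t - c * α ∧ (s + c * β = 1 ∨ t - c * α = 0) := by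
  have hs' : 0 ≤ 1 - s := sub_nonneg.2 hs
  rcases le_total ((1 - s) / β) (t / α) with h | h
  · have h1 : (1 - s) / β * β = 1 - s := div_mul_cancel₀ _ hβ.ne'
    have h2 := (le_div_iff₀ hα).1 h
    exact ⟨(1 - s) / β, div_nonneg hs' hβ.le, by linarith, by linarith, Or.inl (by linarith)⟩
  · have h1 : t / α * α = t := div_mul_cancel₀ _ hα.ne'
    have h2 := (le_div_iff₀ hβ).1 h
    exact ⟨t / α, by positivity, by linarith, by linarith, Or.inr (by linarith)⟩

theorem exists_left_of_mem_parallelogram (ha : a.im < 0) (hb : b.im < 0) (hab : 0 < cross a b)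
    (hz : z ∈ parallelogram p a b) :
    ∃ l ∈ segment ℝ p (p + a) ∪ segment ℝ (p + a) (p + a + b), l.im = z.im ∧ l.re ≤ z.re := by
  obtain ⟨s, hs, t, ht, rfl⟩ := hz
  -- Move from `z` along the horizontal vector `-b.im • a + a.im • b`, which points to the left
  -- because its real part is `-cross a b`, until a coordinate reaches the boundary.
  obtain ⟨c, hc, hs1, ht0, hbd⟩ := exists_nonneg_add_mul_eq_one_or_sub_mul_eq_zero hs.2 ht.1
    (neg_pos.2 ha) (neg_pos.2 hb)
  refine ⟨p + ((s + c * -b.im : ℝ) : ℂ) * a + ((t - c * -a.im : ℝ) : ℂ) * b, ?_, ?_, ?_⟩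
  · rcases hbd with h | h
    · refine Or.inr (mem_segment_add.2 ⟨t - c * -a.im, ⟨ht0, ?_⟩, by rw [h]; simp⟩)
      nlinarith [ht.2]
    · refine Or.inl (mem_segment_add.2 ⟨s + c * -b.im, ⟨?_, hs1⟩, by rw [h]; simp⟩)
      nlinarith [hs.1]
  · simp only [Complex.add_im, Complex.im_ofReal_mul]
    ring
  · have hcab : 0 ≤ c * (a.re * b.im - a.im * b.re) := mul_nonneg hc hab.le
    simp only [Complex.add_re, Complex.re_ofReal_mul]
    linarith

theorem exists_right_of_mem_parallelogram (ha : a.im < 0) (hb : b.im < 0) (hab : 0 < cross a b)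
    (hz : z ∈ parallelogram p a b) :
    ∃ r ∈ segment ℝ p (p + b) ∪ segment ℝ (p + b) (p + b + a), r.im = z.im ∧ z.re ≤ r.re := by
  -- The half-turn about the centre of the parallelogram exchanges the left and the right edges.
  have hturn : p + p + a + b - z ∈ parallelogram p a b := by
    obtain ⟨s, hs, t, ht, rfl⟩ := hz
    exact ⟨1 - s, Icc.mem_iff_one_sub_mem.1 hs, 1 - t, Icc.mem_iff_one_sub_mem.1 ht,
      by push_cast; ring⟩
  obtain ⟨l, hl, him, hre⟩ := exists_left_of_mem_parallelogram ha hb hab hturn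
  simp only [Complex.sub_im, Complex.sub_re, Complex.add_im, Complex.add_re] at him hre
  refine ⟨p + p + a + b - l, ?_, ?_, ?_⟩
  · simp only [mem_union, mem_segment_add] at hl ⊢
    rcases hl with ⟨s, hs, rfl⟩ | ⟨s, hs, rfl⟩
    · exact Or.inr ⟨1 - s, Icc.mem_iff_one_sub_mem.1 hs, by push_cast; ring⟩
    · exact Or.inl ⟨1 - s, Icc.mem_iff_one_sub_mem.1 hs, by push_cast; ring⟩
  · simp only [Complex.sub_im, Complex.add_im]
    linarith
  · simp only [Complex.sub_re, Complex.add_re]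
    linarith

end Parallelogram

section Between

/-- The points of the plane that lie, on their horizontal line, between a point of `L` and a point
of `R`; `polygon θ w` is definitionally of this form. -/
def between (L R : Set ℂ) : Set ℂ :=
  {z | ∃ l ∈ L, ∃ r ∈ R, l.im = z.im ∧ r.im = z.im ∧ l.re ≤ z.re ∧ z.re ≤ r.re}

/-- `L` and `R` meet the same horizontal lines, and `L` lies weakly to the left of `R`. -/
structure LeftOf (L R : Set ℂ) : Prop where
  exists_left : ∀ r ∈ R, ∃ l ∈ L, l.im = r.im ∧ l.re ≤ r.re
  exists_right : ∀ l ∈ L, ∃ r ∈ R, r.im = l.im ∧ l.re ≤ r.re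

variable {L M R S : Set ℂ}

theorem LeftOf.refl (L : Set ℂ) : LeftOf L L :=
  ⟨fun z hz => ⟨z, hz, rfl, le_rfl⟩, fun z hz => ⟨z, hz, rfl, le_rfl⟩⟩

theorem LeftOf.trans (hLM : LeftOf L M) (hMR : LeftOf M R) : LeftOf L R where
  exists_left r hr := by
    obtain ⟨m, hm, hmr, hmr'⟩ := hMR.exists_left r hr
    obtain ⟨l, hl, hlm, hlm'⟩ := hLM.exists_left m hm
    exact ⟨l, hl, hlm.trans hmr, hlm'.trans hmr'⟩
  exists_right l hl := by
    obtain ⟨m, hm, hlm, hlm'⟩ := hLM.exists_right l hl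
    obtain ⟨r, hr, hmr, hmr'⟩ := hMR.exists_right m hm
    exact ⟨r, hr, hmr.trans hlm, hlm'.trans hmr'⟩

theorem LeftOf.left_subset_between (h : LeftOf L R) : L ⊆ between L R := by
  intro l hl
  obtain ⟨r, hr, hlr, hlr'⟩ := h.exists_right l hl
  exact ⟨l, hl, r, hr, rfl, hlr, le_rfl, hlr'⟩

theorem LeftOf.right_subset_between (h : LeftOf L R) : R ⊆ between L R := by
  intro r hr
  obtain ⟨l, hl, hlr, hlr'⟩ := h.exists_left r hr
  exact ⟨l, hl, r, hr, hlr, rfl, hlr', le_rfl⟩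

theorem between_union_between (hLM : LeftOf L M) (hMR : LeftOf M R) :
    between L M ∪ between M R = between L R := by
  apply Subset.antisymm
  · rintro z (⟨l, hl, m, hm, hlz, hmz, hl', hm'⟩ | ⟨m, hm, r, hr, hmz, hrz, hm', hr'⟩)
    · obtain ⟨r, hr, hrm, hmr⟩ := hMR.exists_right m hm
      exact ⟨l, hl, r, hr, hlz, hrm.trans hmz, hl', hm'.trans hmr⟩
    · obtain ⟨l, hl, hlm, hlm'⟩ := hLM.exists_left m hm
      exact ⟨l, hl, r, hr, hlm.trans hmz, hrz, hlm'.trans hm', hr'⟩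
  · rintro z ⟨l, hl, r, hr, hlz, hrz, hl', hr'⟩
    obtain ⟨m, hm, hmr, -⟩ := hMR.exists_left r hr
    rcases le_total z.re m.re with h | h
    · exact Or.inl ⟨l, hl, m, hm, hlz, hmr.trans hrz, hl', h⟩
    · exact Or.inr ⟨m, hm, r, hr, hmr.trans hrz, hrz, h, hr'⟩

theorem eq_of_mem_between {l r z : ℂ} (h : l = r) (hlz : l.im = z.im) (hl : l.re ≤ z.re)
    (hr : z.re ≤ r.re) : z = l := by
  subst h
  exact Complex.ext (le_antisymm hr hl) hlz.symm

theorem between_self (hM : InjOn Complex.im M) : between M M = M := by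
  refine Subset.antisymm ?_ (LeftOf.refl M).left_subset_between
  rintro z ⟨l, hl, r, hr, hlz, hrz, hl', hr'⟩
  rwa [eq_of_mem_between (hM hl hr (hlz.trans hrz.symm)) hlz hl' hr']

theorem between_inter_between_subset (hM : InjOn Complex.im M) :
    between L M ∩ between M R ⊆ M := by
  rintro z ⟨⟨-, -, m, hm, -, hmz, -, hzm⟩, ⟨m', hm', -, -, hmz', -, hzm', -⟩⟩
  rwa [eq_of_mem_between (hM hm' hm (hmz'.trans hmz.symm)) hmz' hzm' hzm]

theorem between_subset_of_convex (hS : Convex ℝ S) (hL : L ⊆ S) (hR : R ⊆ S) :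
    between L R ⊆ S := by
  rintro z ⟨l, hl, r, hr, hlz, hrz, hl', hr'⟩
  obtain ⟨x, y, hx, hy, hxy, h⟩ : z.re ∈ segment ℝ l.re r.re := by
    rw [segment_eq_Icc (hl'.trans hr')]
    exact ⟨hl', hr'⟩
  have hz : z = x • l + y • r := by
    apply Complex.ext
    · simpa using h.symm
    · simp [hlz, hrz, ← add_mul, hxy]
  rw [hz]
  exact hS (hL hl) (hR hr) hx hy hxy

theorem LeftOf.of_subset_union (hL : L ⊆ R ∪ S) (hR : R ⊆ L ∪ S) (hS : S ⊆ between L R) :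
    LeftOf L R where
  exists_left r hr := by
    rcases hR hr with hr | hr
    · exact ⟨r, hr, rfl, le_rfl⟩
    · obtain ⟨l, hl, -, -, him, -, hre, -⟩ := hS hr
      exact ⟨l, hl, him, hre⟩
  exists_right l hl := by
    rcases hL hl with hl | hl
    · exact ⟨l, hl, rfl, le_rfl⟩
    · obtain ⟨-, -, r, hr, -, him, -, hre⟩ := hS hl
      exact ⟨r, hr, him, hre⟩

theorem between_subset_union (hLinj : InjOn Complex.im L) (hRinj : InjOn Complex.im R)
    (hL : L ⊆ R ∪ S) (hR : R ⊆ L ∪ S) (hS : Convex ℝ S) : between L R ⊆ L ∪ S := by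
  rintro z ⟨l, hl, r, hr, hlz, hrz, hl', hr'⟩
  by_cases hlr : l = r
  · rw [eq_of_mem_between hlr hlz hl' hr']
    exact Or.inl hl
  · have hlS := (hL hl).resolve_left fun h => hlr (hRinj h hr (hlz.trans hrz.symm))
    have hrS := (hR hr).resolve_left fun h => hlr (hLinj hl h (hlz.trans hrz.symm))
    exact Or.inr (between_subset_of_convex hS (singleton_subset_iff.2 hlS)
      (singleton_subset_iff.2 hrS) ⟨l, rfl, r, rfl, hlz, hrz, hl', hr'⟩)

theorem interior_eq_empty_of_injOn_im (hM : InjOn Complex.im M) : interior M = ∅ := by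
  refine eq_empty_of_forall_notMem fun z hz => ?_
  have hc : ContinuousAt (fun ε : ℝ => z + ε) 0 := by fun_prop
  have hev : ∀ᶠ ε : ℝ in 𝓝[≠] 0, z + ε ∈ M :=
    (hc.eventually_mem (by simpa using mem_interior_iff_mem_nhds.1 hz)).filter_mono
      nhdsWithin_le_nhds
  obtain ⟨ε, hε, hε0⟩ := (hev.and self_mem_nhdsWithin).exists
  have h := hM hε (interior_subset hz) (by simp)
  exact hε0 (by simpa using h)

theorem disjoint_interior_between (hM : InjOn Complex.im M) :
    Disjoint (interior (between L M)) (interior (between M R)) := by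
  rw [disjoint_iff_inter_eq_empty, ← interior_inter, ← subset_empty_iff,
    ← interior_eq_empty_of_injOn_im hM]
  exact interior_mono (between_inter_between_subset hM)

end Between

section EdgeVectors

variable {n : ℕ} {θ : Fin n → ℝ} {i j : Fin n}

theorem edgeVec_im_neg (hθ : Admissible θ) (i : Fin n) : (edgeVec θ i).im < 0 := by
  have hsin : 0 < Real.sin (θ i - Real.pi) := Real.sin_pos_of_pos_of_lt_pi
    (by linarith [(hθ.2 i).1]) (by linarith [(hθ.2 i).2])
  rw [Real.sin_sub_pi] at hsin
  rw [edgeVec, Complex.exp_ofReal_mul_I_im]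
  linarith

theorem cross_edgeVec_pos (hθ : Admissible θ) (hij : i < j) :
    0 < cross (edgeVec θ i) (edgeVec θ j) := by
  have hsin : 0 < Real.sin (θ j - θ i) := Real.sin_pos_of_pos_of_lt_pi
    (by linarith [hθ.1 hij]) (by linarith [(hθ.2 i).1, (hθ.2 j).2])
  rw [Real.sin_sub] at hsin
  simp only [cross, edgeVec, Complex.exp_ofReal_mul_I_im, Complex.exp_ofReal_mul_I_re]
  linarith

theorem edgeVec_injective (hθ : Admissible θ) : Function.Injective (edgeVec θ) :=
  Function.Injective.of_lt_imp_ne fun i j hij h => by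
    have hpos := cross_edgeVec_pos hθ hij
    rw [h, cross, mul_comm, sub_self] at hpos
    exact hpos.false

end EdgeVectors

section Paths

variable {n : ℕ} {θ : Fin n → ℝ} {u : Equiv.Perm (Fin n)} {j k : Fin n} {z : ℂ}

/-- The path that starts in the top vertex and whose successive sides are labeled `u 0, u 1, …`;
the leftside and the rightside boundary of `X(w)` are definitionally `path θ 1` and `path θ w`. -/
def path (θ : Fin n → ℝ) (u : Equiv.Perm (Fin n)) : Set ℂ := ⋃ k, pathSide θ u k

theorem pathSide_subset_path (θ : Fin n → ℝ) (u : Equiv.Perm (Fin n)) (k : Fin n) :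
    pathSide θ u k ⊆ path θ u :=
  subset_iUnion (pathSide θ u) k

theorem vertex_zero (θ : Fin n → ℝ) (u : Equiv.Perm (Fin n)) : vertex θ u 0 = 0 := by
  simp [vertex]

theorem vertex_succ (θ : Fin n → ℝ) (u : Equiv.Perm (Fin n)) (k : Fin n) :
    vertex θ u (k.val + 1) = vertex θ u k.val + edgeVec θ (u k) := by
  have hfilter : (Finset.univ.filter fun i : Fin n => i.val < k.val + 1)
      = insert k (Finset.univ.filter fun i : Fin n => i.val < k.val) := by
    ext i
    simp only [Finset.mem_filter_univ, Finset.mem_insert, Fin.ext_iff]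
    omega
  rw [vertex, hfilter, Finset.sum_insert (by simp), add_comm, vertex]

theorem vertex_last (θ : Fin n → ℝ) (u : Equiv.Perm (Fin n)) :
    vertex θ u n = ∑ i, edgeVec θ i := by
  simp [vertex, Equiv.sum_comp u (edgeVec θ)]

theorem pathSide_eq_segment_add (θ : Fin n → ℝ) (u : Equiv.Perm (Fin n)) (k : Fin n) :
    pathSide θ u k = segment ℝ (vertex θ u k) (vertex θ u k + edgeVec θ (u k)) := by
  rw [pathSide, vertex_succ]

theorem pathSide_eq_segment_add_add (θ : Fin n → ℝ) (u : Equiv.Perm (Fin n))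
    (hjk : k.val = j.val + 1) :
    pathSide θ u k = segment ℝ (vertex θ u j + edgeVec θ (u j))
      (vertex θ u j + edgeVec θ (u j) + edgeVec θ (u k)) := by
  rw [pathSide, vertex_succ, hjk, vertex_succ]

theorem eq_of_pathSide_eq_segment_add (hθ : Admissible θ) {p : ℂ} {i : Fin n}
    (h : pathSide θ u k = segment ℝ p (p + edgeVec θ i)) : u k = i := by
  rw [pathSide_eq_segment_add] at h
  exact edgeVec_injective hθ (segment_add_inj (edgeVec_im_neg hθ _) (edgeVec_im_neg hθ _) h).2

theorem strictAntiOn_vertex_im (hθ : Admissible θ) (u : Equiv.Perm (Fin n)) :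
    StrictAntiOn (fun m => (vertex θ u m).im) (Iic n) := by
  refine strictAntiOn_Iic_of_succ_lt fun m hm => ?_
  have hstep := congrArg Complex.im (vertex_succ θ u ⟨m, hm⟩)
  have hneg := edgeVec_im_neg hθ (u ⟨m, hm⟩)
  simp only [Complex.add_im] at hstep
  simp only [Order.succ_eq_add_one]
  linarith

theorem im_mem_Icc_of_mem_pathSide (hθ : Admissible θ) (hz : z ∈ pathSide θ u k) :
    z.im ∈ Icc (vertex θ u (k.val + 1)).im (vertex θ u k).im := by
  rw [pathSide_eq_segment_add, mem_segment_add] at hz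
  obtain ⟨s, hs, rfl⟩ := hz
  have hneg := edgeVec_im_neg hθ (u k)
  simp only [vertex_succ, mem_Icc, Complex.add_im, Complex.im_ofReal_mul]
  constructor <;> nlinarith [hs.1, hs.2]

theorem injOn_im_pathSide (hθ : Admissible θ) (u : Equiv.Perm (Fin n)) (k : Fin n) :
    InjOn Complex.im (pathSide θ u k) := by
  rw [pathSide_eq_segment_add]
  intro z hz z' hz' h
  obtain ⟨s, -, rfl⟩ := mem_segment_add.1 hz
  obtain ⟨s', -, rfl⟩ := mem_segment_add.1 hz'
  simp only [Complex.add_im, Complex.im_ofReal_mul, add_right_inj] at h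
  rw [mul_right_cancel₀ (edgeVec_im_neg hθ (u k)).ne h]

theorem mem_pathSide_of_mem_path (hθ : Admissible θ) (hz : z ∈ path θ u)
    (hup : k.val = 0 ∨ z.im < (vertex θ u k).im)
    (hlow : k.val + 1 = n ∨ (vertex θ u (k.val + 1)).im < z.im) : z ∈ pathSide θ u k := by
  obtain ⟨i, hi⟩ := mem_iUnion.1 hz
  have him := im_mem_Icc_of_mem_pathSide hθ hi
  have hanti := (strictAntiOn_vertex_im hθ u).antitoneOn
  rcases lt_trichotomy i k with hik | rfl | hki
  · have hle := hanti (a := i.val + 1) (b := k) i.isLt k.isLt.le hik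
    rcases hup with hk | hk
    · simp [Fin.lt_def, hk] at hik
    · exact absurd (him.1.trans_lt hk) hle.not_gt
  · exact hi
  · have hle := hanti (a := k.val + 1) (b := i) k.isLt i.isLt.le hki
    rcases hlow with hk | hk
    · exact absurd (Fin.lt_def.1 hki) (by omega)
    · exact absurd (hk.trans_le him.2) hle.not_gt

theorem injOn_im_path (hθ : Admissible θ) (u : Equiv.Perm (Fin n)) :
    InjOn Complex.im (path θ u) := by
  intro z hz z' hz' h
  obtain ⟨k, hk⟩ := mem_iUnion.1 hz
  obtain ⟨l, hl⟩ := mem_iUnion.1 hz'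
  wlog hkl : k ≤ l generalizing z z' k l
  · exact (this hz' hz h.symm l hl k hk (le_of_not_ge hkl)).symm
  rcases hkl.eq_or_lt with rfl | hkl
  · exact injOn_im_pathSide hθ u k hk hl h
  have hkl' : k.val + 1 ≤ l.val := hkl
  have hz₁ := (im_mem_Icc_of_mem_pathSide hθ hk).1
  have hz₂ := (im_mem_Icc_of_mem_pathSide hθ hl).2
  -- Side `l` lies below side `k`, so both points are the common vertex of two consecutive sides.
  have hanti := strictAntiOn_vertex_im hθ u
  have hval : k.val + 1 = l.val := hkl'.antisymm
    ((hanti.le_iff_ge (a := k.val + 1) (b := l) k.isLt l.isLt.le).1 (by grind))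
  rw [← hval] at hz₂
  have hzv := injOn_im_pathSide hθ u k hk (right_mem_segment ℝ _ _) (by grind)
  have hzv' := injOn_im_pathSide hθ u l hl (left_mem_segment ℝ _ _) (by rw [← hval]; grind)
  rw [hzv, hzv', hval]

end Paths

section Descents

variable {n : ℕ} {θ : Fin n → ℝ} {u w : Equiv.Perm (Fin n)} {i j k : Fin n}

/-- `j` and `k = j + 1` are adjacent positions at which `w` descends. -/
def IsDescent (w : Equiv.Perm (Fin n)) (j k : Fin n) : Prop := k.val = j.val + 1 ∧ w k < w j

theorem isDescent_of_le (hjk : k.val = j.val + 1) (h : w k ≤ w j) : IsDescent w j k :=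
  ⟨hjk, h.lt_of_ne (w.injective.ne (Fin.ne_of_val_ne (by omega)))⟩

theorem exists_isDescent (hw : w ≠ 1) : ∃ j k, IsDescent w j k := by
  contrapose! hw
  rw [← Equiv.Perm.monotone_iff]
  cases n with
  | zero => exact fun i => i.elim0
  | succ m =>
    refine Fin.monotone_iff_le_succ.2 fun i => ?_
    by_contra! h
    exact hw _ _ (isDescent_of_le (by simp) h.le)

theorem IsDescent.toLex_mul_swap_lt (h : IsDescent w j k) :
    toLex ⇑(w * Equiv.swap j k) < toLex ⇑w := by
  refine ⟨j, fun i (hi : i < j) => ?_, by simpa using h.2⟩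
  have hik : i ≠ k := Fin.ne_of_val_ne (by have := h.1; have := Fin.lt_def.1 hi; omega)
  simp [Equiv.swap_apply_of_ne_of_ne hi.ne hik]

theorem descent_induction {P : Equiv.Perm (Fin n) → Prop}
    (ih : ∀ u, (∀ j k, IsDescent u j k → P (u * Equiv.swap j k)) → P u) (u : Equiv.Perm (Fin n)) :
    P u := by
  have hwf : WellFounded fun u v : Equiv.Perm (Fin n) => toLex ⇑u < toLex ⇑v :=
    wellFounded_lt.onFun
  exact hwf.induction u fun u hu => ih u fun j k h => hu _ h.toLex_mul_swap_lt

theorem vertex_mul_swap (hjk : k.val = j.val + 1) {m : ℕ} (hm : m ≠ j.val + 1) :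
    vertex θ (u * Equiv.swap j k) m = vertex θ u m := by
  refine Finset.sum_equiv (Equiv.swap j k) (fun i => ?_) (by simp)
  simp only [Finset.mem_filter_univ, Equiv.swap_apply_def]
  grind

theorem pathSide_mul_swap_of_ne (hjk : k.val = j.val + 1) (hij : i ≠ j) (hik : i ≠ k) :
    pathSide θ (u * Equiv.swap j k) i = pathSide θ u i := by
  have hij' := Fin.val_ne_of_ne hij
  have hik' := Fin.val_ne_of_ne hik
  rw [pathSide, pathSide, vertex_mul_swap hjk (by omega), vertex_mul_swap hjk (by omega)]

theorem pathSide_mul_swap_fst (hjk : k.val = j.val + 1) :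
    pathSide θ (w * Equiv.swap j k) j =
      segment ℝ (vertex θ w j) (vertex θ w j + edgeVec θ (w k)) := by
  rw [pathSide_eq_segment_add, vertex_mul_swap hjk (by omega)]
  simp

theorem pathSide_mul_swap_snd (hjk : k.val = j.val + 1) :
    pathSide θ (w * Equiv.swap j k) k = segment ℝ (vertex θ w j + edgeVec θ (w k))
      (vertex θ w j + edgeVec θ (w k) + edgeVec θ (w j)) := by
  rw [pathSide_eq_segment_add_add θ _ hjk, vertex_mul_swap hjk (by omega)]
  simp

/-- The rhombus between the path of `w * swap j k` on its left and the path of `w` on its right, for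
a descent `(j, k)` of `w`. -/
noncomputable def descentTile (θ : Fin n → ℝ) (h : IsDescent w j k) : Tile n :=
  ⟨vertex θ w j, w k, w j, h.2⟩

theorem pathSide_mem_edges_descentTile (θ : Fin n → ℝ) (h : IsDescent w j k)
    (hi : i = j ∨ i = k) : pathSide θ w i ∈ (descentTile θ h).edges θ := by
  rcases hi with rfl | rfl
  · simp [pathSide_eq_segment_add, Tile.edges, descentTile]
  · simp [pathSide_eq_segment_add_add θ w h.1, add_right_comm, Tile.edges, descentTile]

theorem pathSide_mul_swap_mem_edges_descentTile (θ : Fin n → ℝ) (h : IsDescent w j k)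
    (hi : i = j ∨ i = k) :
    pathSide θ (w * Equiv.swap j k) i ∈ (descentTile θ h).edges θ := by
  rcases hi with rfl | rfl
  · simp [pathSide_mul_swap_fst h.1, Tile.edges, descentTile]
  · simp [pathSide_mul_swap_snd h.1, Tile.edges, descentTile]

theorem Tile.subset_carrier_of_mem_edges {t : Tile n} {E : Set ℂ} (hE : E ∈ t.edges θ) :
    E ⊆ t.carrier θ := by
  have hcomm : t.carrier θ = parallelogram t.top (edgeVec θ t.hi) (edgeVec θ t.lo) :=
    parallelogram_comm _ _ _
  rcases hE with rfl | rfl | rfl | rfl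
  · exact segment_subset_parallelogram
  · exact hcomm ▸ segment_subset_parallelogram
  · exact segment_add_subset_parallelogram
  · rw [hcomm, add_right_comm]
    exact segment_add_subset_parallelogram

theorem path_subset_path_mul_swap_union (θ : Fin n → ℝ) (h : IsDescent w j k) :
    path θ w ⊆ path θ (w * Equiv.swap j k) ∪ (descentTile θ h).carrier θ := by
  refine iUnion_subset fun i => ?_
  by_cases hi : i = j ∨ i = k
  · exact subset_union_of_subset_right
      (Tile.subset_carrier_of_mem_edges (pathSide_mem_edges_descentTile θ h hi)) _
  · rw [not_or] at hi
    rw [← pathSide_mul_swap_of_ne h.1 hi.1 hi.2]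
    exact subset_union_of_subset_left (pathSide_subset_path θ _ i) _

theorem path_mul_swap_subset_path_union (θ : Fin n → ℝ) (h : IsDescent w j k) :
    path θ (w * Equiv.swap j k) ⊆ path θ w ∪ (descentTile θ h).carrier θ := by
  refine iUnion_subset fun i => ?_
  by_cases hi : i = j ∨ i = k
  · exact subset_union_of_subset_right
      (Tile.subset_carrier_of_mem_edges (pathSide_mul_swap_mem_edges_descentTile θ h hi)) _
  · rw [not_or] at hi
    rw [pathSide_mul_swap_of_ne h.1 hi.1 hi.2]
    exact subset_union_of_subset_left (pathSide_subset_path θ _ i) _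

theorem carrier_descentTile_subset_between (hθ : Admissible θ) (h : IsDescent w j k) :
    (descentTile θ h).carrier θ ⊆ between (path θ (w * Equiv.swap j k)) (path θ w) := by
  intro z hz
  have hcross := cross_edgeVec_pos hθ h.2
  obtain ⟨l, hl, hlz, hlz'⟩ := exists_left_of_mem_parallelogram
    (edgeVec_im_neg hθ _) (edgeVec_im_neg hθ _) hcross hz
  obtain ⟨r, hr, hrz, hrz'⟩ := exists_right_of_mem_parallelogram
    (edgeVec_im_neg hθ _) (edgeVec_im_neg hθ _) hcross hz
  refine ⟨l, ?_, r, ?_, hlz, hrz, hlz', hrz'⟩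
  · refine union_subset (pathSide_subset_path θ _ j) (pathSide_subset_path θ _ k) ?_
    rwa [pathSide_mul_swap_fst h.1, pathSide_mul_swap_snd h.1]
  · refine union_subset (pathSide_subset_path θ _ j) (pathSide_subset_path θ _ k) ?_
    rwa [pathSide_eq_segment_add, pathSide_eq_segment_add_add θ w h.1]

theorem leftOf_path_mul_swap (hθ : Admissible θ) (h : IsDescent w j k) :
    LeftOf (path θ (w * Equiv.swap j k)) (path θ w) :=
  .of_subset_union (path_mul_swap_subset_path_union θ h) (path_subset_path_mul_swap_union θ h)
    (carrier_descentTile_subset_between hθ h)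

theorem leftOf_path_one (hθ : Admissible θ) (u : Equiv.Perm (Fin n)) :
    LeftOf (path θ 1) (path θ u) := by
  induction u using descent_induction with
  | ih u ih =>
    by_cases hu : u = 1
    · exact hu ▸ .refl _
    · obtain ⟨j, k, h⟩ := exists_isDescent hu
      exact (ih j k h).trans (leftOf_path_mul_swap hθ h)

theorem polygon_mul_swap_union (hθ : Admissible θ) (h : IsDescent w j k) :
    polygon θ (w * Equiv.swap j k) ∪ (descentTile θ h).carrier θ = polygon θ w := by
  have hunion := between_union_between (leftOf_path_one hθ _) (leftOf_path_mul_swap hθ h)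
  refine Subset.antisymm ?_ (hunion.symm.subset.trans (union_subset subset_union_left ?_))
  · exact (union_subset_union_right _ (carrier_descentTile_subset_between hθ h)).trans
      hunion.subset
  · exact (between_subset_union (injOn_im_path hθ _) (injOn_im_path hθ _)
      (path_mul_swap_subset_path_union θ h) (path_subset_path_mul_swap_union θ h)
      (convex_parallelogram _ _ _)).trans
      (union_subset_union_left _ (leftOf_path_one hθ _).right_subset_between)

theorem disjoint_interior_polygon_mul_swap (hθ : Admissible θ) (h : IsDescent w j k) :
    Disjoint (interior (polygon θ (w * Equiv.swap j k)))
      (interior ((descentTile θ h).carrier θ)) :=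
  (disjoint_interior_between (injOn_im_path hθ _)).mono_right
    (interior_mono (carrier_descentTile_subset_between hθ h))

end Descents

section Tilings

variable {n : ℕ} {θ : Fin n → ℝ} {w : Equiv.Perm (Fin n)} {T : Finset (Tile n)} {j k : Fin n}

/-- `T` tiles the region between the leftside boundary and the path of `w`, except that a side
which both have in common need not be covered. -/
structure IsPartialTiling (θ : Fin n → ℝ) (w : Equiv.Perm (Fin n)) (T : Finset (Tile n)) :
    Prop where
  iUnion_union : (⋃ t ∈ T, t.carrier θ) ∪ path θ 1 = polygon θ w
  pairwise : (T : Set (Tile n)).Pairwise fun s t =>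
    Disjoint (interior (s.carrier θ)) (interior (t.carrier θ))
  subset_or_eq : ∀ k, leftSide θ k ⊆ ⋃ t ∈ T, t.carrier θ ∨ leftSide θ k = rightSide θ w k

theorem isPartialTiling_one (hθ : Admissible θ) : IsPartialTiling θ 1 ∅ where
  iUnion_union := by
    change _ = between (path θ 1) (path θ 1)
    simp [between_self (injOn_im_path hθ 1)]
  pairwise := by simp
  subset_or_eq _ := Or.inr rfl

open Classical in
theorem IsPartialTiling.insert_descentTile (hθ : Admissible θ) (h : IsDescent w j k)
    (hT : IsPartialTiling θ (w * Equiv.swap j k) T) :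
    IsPartialTiling θ w (insert (descentTile θ h) T) where
  iUnion_union := by
    rw [Finset.set_biUnion_insert, union_assoc, hT.iUnion_union, union_comm,
      polygon_mul_swap_union hθ h]
  pairwise := by
    rw [Finset.coe_insert]
    refine hT.pairwise.insert fun t ht _ => ?_
    have hsub : t.carrier θ ⊆ polygon θ (w * Equiv.swap j k) :=
      hT.iUnion_union ▸ subset_union_of_subset_left
        (subset_biUnion_of_mem (u := fun t : Tile n => t.carrier θ) ht) _
    have hdisj := (disjoint_interior_polygon_mul_swap hθ h).mono_left (interior_mono hsub)
    exact ⟨hdisj.symm, hdisj⟩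
  subset_or_eq i := by
    rw [Finset.set_biUnion_insert]
    rcases hT.subset_or_eq i with hi | hi
    · exact Or.inl (hi.trans subset_union_right)
    by_cases hijk : i = j ∨ i = k
    · rw [hi]
      exact Or.inl (subset_union_of_subset_left
        (Tile.subset_carrier_of_mem_edges (pathSide_mul_swap_mem_edges_descentTile θ h hijk)) _)
    · rw [not_or] at hijk
      exact Or.inr (hi.trans (pathSide_mul_swap_of_ne h.1 hijk.1 hijk.2))

theorem exists_isPartialTiling (hθ : Admissible θ) (w : Equiv.Perm (Fin n)) :
    ∃ T, IsPartialTiling θ w T := by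
  induction w using descent_induction with
  | ih w ih =>
    by_cases hw : w = 1
    · exact ⟨∅, hw ▸ isPartialTiling_one hθ⟩
    · obtain ⟨j, k, h⟩ := exists_isDescent hw
      obtain ⟨T, hT⟩ := ih j k h
      exact ⟨_, hT.insert_descentTile hθ h⟩

theorem IsPartialTiling.isRhombicTiling (hT : IsPartialTiling θ w T)
    (h : ∀ k, leftSide θ k ≠ rightSide θ w k) : IsRhombicTiling θ w T := by
  refine ⟨?_, hT.pairwise⟩
  rw [← hT.iUnion_union, eq_comm, union_eq_left]
  exact iUnion_subset fun k => (hT.subset_or_eq k).resolve_right (h k)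

theorem IsRhombicTiling.nonempty_interior_inter (hθ : Admissible θ) (hT : IsRhombicTiling θ w T)
    {t : Tile n} (ht : t ∈ T) {p : ℂ} (hp : p ∈ t.carrier θ) {S : Set ℂ}
    (hS : S ∈ 𝓝[polygon θ w] p) : (interior (t.carrier θ) ∩ interior S).Nonempty := by
  have hsub : interior (t.carrier θ) ⊆ polygon θ w := interior_subset.trans
    (hT.1 ▸ subset_biUnion_of_mem (u := fun t : Tile n => t.carrier θ) ht)
  obtain ⟨U, hU, hpU, hUS⟩ := mem_nhdsWithin.1 (nhdsWithin_mono p hsub hS)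
  have hpc := parallelogram_subset_closure_interior _ (cross_edgeVec_pos hθ t.lo_lt_hi).ne' hp
  obtain ⟨z, hzU, hzt⟩ := mem_closure_iff.1 hpc U hU hpU
  exact ⟨z, hzt, interior_maximal hUS (hU.inter isOpen_interior) ⟨hzU, hzt⟩⟩

end Tilings

section Localization

variable {n : ℕ} {θ : Fin n → ℝ} {u v w : Equiv.Perm (Fin n)} {T : Finset (Tile n)} {k : Fin n}
  {p : ℂ}

/-- On the horizontal lines near `p`, the path of `u` has no points outside its `k`-th side. -/
def IsOnlySideNear (θ : Fin n → ℝ) (u : Equiv.Perm (Fin n)) (k : Fin n) (p : ℂ) : Prop :=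
  ∀ᶠ y in 𝓝 p.im, ∀ z ∈ path θ u, z.im = y → z ∈ pathSide θ u k

theorem isOnlySideNear (hθ : Admissible θ) (hup : k.val = 0 ∨ p.im < (vertex θ u k).im)
    (hlow : k.val + 1 = n ∨ (vertex θ u (k.val + 1)).im < p.im) : IsOnlySideNear θ u k p := by
  have hup' : ∀ᶠ y in 𝓝 p.im, k.val = 0 ∨ y < (vertex θ u k).im :=
    hup.elim (fun h => .of_forall fun _ => .inl h)
      fun h => (eventually_lt_nhds h).mono fun _ => .inr
  have hlow' : ∀ᶠ y in 𝓝 p.im, k.val + 1 = n ∨ (vertex θ u (k.val + 1)).im < y :=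
    hlow.elim (fun h => .of_forall fun _ => .inl h)
      fun h => (eventually_gt_nhds h).mono fun _ => .inr
  filter_upwards [hup', hlow'] with y hy hy' z hz hzy
  subst hzy
  exact mem_pathSide_of_mem_path hθ hz hy hy'

theorem between_mem_nhdsWithin (hl : IsOnlySideNear θ 1 k p) (hr : IsOnlySideNear θ w k p) :
    between (leftSide θ k) (rightSide θ w k) ∈ 𝓝[polygon θ w] p := by
  rw [mem_nhdsWithin_iff_eventually]
  filter_upwards [(Complex.continuous_im.tendsto p).eventually (hl.and hr)]
  rintro z ⟨hl, hr⟩ ⟨l, hlp, r, hrp, hlz, hrz, hlz', hrz'⟩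
  exact ⟨l, hl l hlp hlz, r, hr r hrp hrz, hlz, hrz, hlz', hrz'⟩

theorem vertex_eq_of_pathSide_eq (hθ : Admissible θ) (h : pathSide θ u k = pathSide θ v k) :
    vertex θ u k = vertex θ v k ∧ vertex θ u (k.val + 1) = vertex θ v (k.val + 1) := by
  rw [pathSide_eq_segment_add, pathSide_eq_segment_add] at h
  obtain ⟨hvertex, hedge⟩ := segment_add_inj (edgeVec_im_neg hθ _) (edgeVec_im_neg hθ _) h
  exact ⟨hvertex, by rw [vertex_succ, vertex_succ, hvertex, hedge]⟩

theorem exists_isOnlySideNear (hθ : Admissible θ) (h : pathSide θ u k = pathSide θ v k) :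
    ∃ p ∈ pathSide θ u k, IsOnlySideNear θ u k p ∧ IsOnlySideNear θ v k p := by
  obtain ⟨hv, hv'⟩ := vertex_eq_of_pathSide_eq hθ h
  have hlt : (vertex θ u (k.val + 1)).im < (vertex θ u k).im :=
    strictAntiOn_vertex_im hθ u (mem_Iic.2 k.isLt.le) (mem_Iic.2 k.isLt) k.val.lt_succ_self
  set p := midpoint ℝ (vertex θ u k) (vertex θ u (k.val + 1))
  have him : p.im = midpoint ℝ (vertex θ u k).im (vertex θ u (k.val + 1)).im :=
    Complex.imLm.toAffineMap.map_midpoint _ _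
  have hup : p.im < (vertex θ u k).im := him ▸ lt_of_not_ge (mt left_le_midpoint.1 hlt.not_ge)
  have hlow : (vertex θ u (k.val + 1)).im < p.im :=
    him ▸ lt_of_not_ge (mt midpoint_le_right.1 hlt.not_ge)
  exact ⟨p, midpoint_mem_segment _ _, isOnlySideNear hθ (.inr hup) (.inr hlow),
    isOnlySideNear hθ (.inr (hv ▸ hup)) (.inr (hv' ▸ hlow))⟩

theorem IsRhombicTiling.leftSide_ne_rightSide (hθ : Admissible θ) (hT : IsRhombicTiling θ w T)
    (k : Fin n) : leftSide θ k ≠ rightSide θ w k := by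
  intro heq
  obtain ⟨p, hpk, hl, hr⟩ := exists_isOnlySideNear hθ heq
  have hpX : p ∈ polygon θ w :=
    (leftOf_path_one hθ w).left_subset_between (pathSide_subset_path θ 1 k hpk)
  rw [← hT.1] at hpX
  obtain ⟨t, ht, hpt⟩ := mem_iUnion₂.1 hpX
  obtain ⟨z, -, hz⟩ := hT.nonempty_interior_inter hθ ht hpt (between_mem_nhdsWithin hl hr)
  have hinj : InjOn Complex.im (leftSide θ k) := injOn_im_pathSide hθ 1 k
  rwa [← heq, between_self hinj, interior_eq_empty_of_injOn_im hinj] at hz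

end Localization

section Corners

variable {n : ℕ} {θ : Fin n → ℝ} {u v w : Equiv.Perm (Fin n)} {T : Finset (Tile n)}
  {s t : Tile n} {a b e : Fin n}

/-- `e` is the first or the last element of `Fin n`. As a position this means that the `e`-th sides
of all paths share the top or the bottom vertex of `X(w)`. -/
def IsExtreme (e : Fin n) : Prop := e.val = 0 ∨ e.val + 1 = n

/-- The tile has as edges the `e`-th sides of both boundaries of `X(w)`. For the first and the last
position `e` these are the top- and the bottom-perimeter tiles. -/
def IsCornerTile (θ : Fin n → ℝ) (w : Equiv.Perm (Fin n)) (e : Fin n) (t : Tile n) : Prop :=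
  leftSide θ e ∈ t.edges θ ∧ rightSide θ w e ∈ t.edges θ

theorem IsExtreme.pathSide_congr (he : IsExtreme e) (h : u e = v e) :
    pathSide θ u e = pathSide θ v e := by
  have hstep : vertex θ u (e.val + 1) - vertex θ u e = vertex θ v (e.val + 1) - vertex θ v e := by
    simp only [vertex_succ, h, add_sub_cancel_left]
  rcases he with he | he
  · rw [he, vertex_zero, vertex_zero, sub_zero, sub_zero] at hstep
    rw [pathSide, pathSide, he, vertex_zero, vertex_zero, hstep]
  · rw [he, vertex_last, vertex_last, sub_right_inj] at hstep
    rw [pathSide, pathSide, he, vertex_last, vertex_last, hstep]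

theorem IsExtreme.exists_isDescent (he : IsExtreme e) (hw : w e ≠ e) :
    ∃ j k, IsDescent w j k ∧ ((w * Equiv.swap j k) e = e ∨ (w * Equiv.swap j k) e = w e) := by
  -- Exchange the label `e`, found in position `i`, with its neighbour in the direction of position
  -- `e`.
  obtain ⟨i, hi⟩ := w.surjective e
  have hie : e ≠ i := by
    rintro rfl
    exact hw hi
  have hie' := Fin.val_ne_of_ne hie
  rcases he with he | he
  · refine ⟨⟨i.val - 1, by omega⟩, i, isDescent_of_le (by simp only; omega) ?_, ?_⟩
    · rw [hi, Fin.le_def]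
      omega
    · rcases eq_or_ne e ⟨i.val - 1, by omega⟩ with h | h
      · left
        simp [← h, hi]
      · right
        simp [Equiv.swap_apply_of_ne_of_ne h hie]
  · have hi' : i.val + 1 < n := by omega
    refine ⟨i, ⟨i.val + 1, hi'⟩, isDescent_of_le rfl ?_, ?_⟩
    · rw [hi, Fin.le_def]
      omega
    · rcases eq_or_ne e ⟨i.val + 1, hi'⟩ with h | h
      · left
        simp [← h, hi]
      · right
        simp [Equiv.swap_apply_of_ne_of_ne hie h]

theorem exists_isPartialTiling_isCornerTile (hθ : Admissible θ) (he : IsExtreme e) (hw : w e ≠ e) :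
    ∃ T, IsPartialTiling θ w T ∧ ∃ s ∈ T, IsCornerTile θ w e s := by
  classical
  induction w using descent_induction with
  | ih w ih =>
    obtain ⟨j, k, h, hlast | hkeep⟩ := he.exists_isDescent hw
    · obtain ⟨T, hT⟩ := exists_isPartialTiling hθ (w * Equiv.swap j k)
      refine ⟨_, hT.insert_descentTile hθ h, _, Finset.mem_insert_self _ _, ?_⟩
      have hejk : e = j ∨ e = k := by
        by_contra! hne
        rw [Equiv.Perm.mul_apply, Equiv.swap_apply_of_ne_of_ne hne.1 hne.2] at hlast
        exact hw hlast
      have hleft : leftSide θ e = pathSide θ (w * Equiv.swap j k) e :=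
        he.pathSide_congr hlast.symm
      exact ⟨hleft ▸ pathSide_mul_swap_mem_edges_descentTile θ h hejk,
        pathSide_mem_edges_descentTile θ h hejk⟩
    · obtain ⟨T, hT, s, hs, hse⟩ := ih j k h (hkeep.trans_ne hw)
      have hright : rightSide θ (w * Equiv.swap j k) e = rightSide θ w e := he.pathSide_congr hkeep
      exact ⟨_, hT.insert_descentTile hθ h, s, Finset.mem_insert_of_mem hs, hse.1, hright ▸ hse.2⟩

theorem IsExtreme.exists_corner (hθ : Admissible θ) (he : IsExtreme e) :
    ∃ p, ∀ u, p ∈ pathSide θ u e ∧ IsOnlySideNear θ u e p := by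
  have hlt : ∀ u, (vertex θ u (e.val + 1)).im < (vertex θ u e).im := fun u =>
    strictAntiOn_vertex_im hθ u (mem_Iic.2 e.isLt.le) (mem_Iic.2 e.isLt) e.val.lt_succ_self
  rcases he with he | he
  · have hv : ∀ u, vertex θ u e = 0 := fun u => by rw [he, vertex_zero]
    exact ⟨0, fun u => ⟨hv u ▸ left_mem_segment ℝ _ _,
      isOnlySideNear hθ (.inl he) (.inr (hv u ▸ hlt u))⟩⟩
  · have hv : ∀ u, vertex θ u (e.val + 1) = ∑ i, edgeVec θ i := fun u => by rw [he, vertex_last]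
    exact ⟨∑ i, edgeVec θ i, fun u => ⟨hv u ▸ right_mem_segment ℝ _ _,
      isOnlySideNear hθ (.inr (hv u ▸ hlt u)) (.inl he)⟩⟩

theorem IsRhombicTiling.eq_of_isCornerTile (hθ : Admissible θ) (hT : IsRhombicTiling θ w T)
    (he : IsExtreme e) (hs : s ∈ T) (hse : IsCornerTile θ w e s) (ht : t ∈ T)
    (hte : leftSide θ e ∈ t.edges θ ∨ rightSide θ w e ∈ t.edges θ) : t = s := by
  obtain ⟨p, hp⟩ := he.exists_corner hθ
  have hpt : p ∈ t.carrier θ := hte.elim (fun h => t.subset_carrier_of_mem_edges h (hp 1).1)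
    fun h => t.subset_carrier_of_mem_edges h (hp w).1
  have hnhds : s.carrier θ ∈ 𝓝[polygon θ w] p :=
    mem_of_superset (between_mem_nhdsWithin (hp 1).2 (hp w).2)
      (between_subset_of_convex (convex_parallelogram _ _ _)
        (s.subset_carrier_of_mem_edges hse.1) (s.subset_carrier_of_mem_edges hse.2))
  by_contra hts
  exact not_disjoint_iff_nonempty_inter.2 (hT.nonempty_interior_inter hθ ht hpt hnhds)
    (hT.2 ht hs hts)

theorem isCornerTile_of_forall_mem (hθ : Admissible θ) (he : IsExtreme e)
    (h : ∀ T, IsRhombicTiling θ w T →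
      t ∈ T ∧ (leftSide θ e ∈ t.edges θ ∨ rightSide θ w e ∈ t.edges θ))
    (hT : IsRhombicTiling θ w T) : IsCornerTile θ w e t := by
  have hne := hT.leftSide_ne_rightSide hθ
  have hw : w e ≠ e := fun hwe => hne e (he.pathSide_congr (u := 1) hwe.symm)
  obtain ⟨T', hT', s, hs, hse⟩ := exists_isPartialTiling_isCornerTile hθ he hw
  obtain ⟨ht, hte⟩ := h T' (hT'.isRhombicTiling hne)
  exact (hT'.isRhombicTiling hne).eq_of_isCornerTile hθ he hs hse ht hte ▸ hse

theorem Tile.apply_mem_labels_of_pathSide_mem_edges (hθ : Admissible θ)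
    (h : pathSide θ u a ∈ t.edges θ) : u a ∈ t.labels := by
  rw [Tile.labels, Finset.mem_insert, Finset.mem_singleton]
  rcases h with h | h | h | h
  · exact Or.inl (eq_of_pathSide_eq_segment_add hθ h)
  · exact Or.inr (eq_of_pathSide_eq_segment_add hθ h)
  · exact Or.inr (eq_of_pathSide_eq_segment_add hθ h)
  · rw [add_right_comm] at h
    exact Or.inl (eq_of_pathSide_eq_segment_add hθ h)

theorem pathSide_mem_edges_of_labels_eq (hθ : Admissible θ) (hab : b.val = a.val + 1)
    (hl : t.labels = {u a, u b})
    (h : ∃ j k : Fin n, k.val = j.val + 1 ∧ pathSide θ u j ∈ t.edges θ ∧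
      pathSide θ u k ∈ t.edges θ) :
    pathSide θ u a ∈ t.edges θ ∧ pathSide θ u b ∈ t.edges θ := by
  obtain ⟨j, k, hjk, hj, hk⟩ := h
  have hjl := Tile.apply_mem_labels_of_pathSide_mem_edges hθ hj
  have hkl := Tile.apply_mem_labels_of_pathSide_mem_edges hθ hk
  simp only [hl, Finset.mem_insert, Finset.mem_singleton, u.apply_eq_iff_eq, Fin.ext_iff] at hjl hkl
  obtain rfl : j = a := Fin.ext (by omega)
  obtain rfl : k = b := Fin.ext (by omega)
  exact ⟨hj, hk⟩

theorem isForcedTop_of_forall_mem (hθ : Admissible θ) (he : e.val = 0)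
    (h : ∀ T, IsRhombicTiling θ w T →
      t ∈ T ∧ (leftSide θ e ∈ t.edges θ ∨ rightSide θ w e ∈ t.edges θ)) : IsForcedTop θ w t :=
  fun T hT => ⟨(h T hT).1, e, he, isCornerTile_of_forall_mem hθ (.inl he) h hT⟩

theorem isForcedBottom_of_forall_mem (hθ : Admissible θ) (he : e.val + 1 = n)
    (h : ∀ T, IsRhombicTiling θ w T →
      t ∈ T ∧ (leftSide θ e ∈ t.edges θ ∨ rightSide θ w e ∈ t.edges θ)) : IsForcedBottom θ w t :=
  fun T hT => ⟨(h T hT).1, e, he, isCornerTile_of_forall_mem hθ (.inr he) h hT⟩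

end Corners

end Elnitsky

open Elnitsky in
theorem corollary4_general (n : ℕ) (hn : 2 ≤ n) (w : Equiv.Perm (Fin n)) (θ : Fin n → ℝ)
    (hθ : Admissible θ) :
    (∀ t : Tile n, t.labels = {w ⟨0, Nat.zero_lt_of_lt hn⟩, w ⟨1, hn⟩} →
      IsForcedRight θ w t → IsForcedTop θ w t) ∧
    (∀ t : Tile n, t.labels = {⟨0, Nat.zero_lt_of_lt hn⟩, ⟨1, hn⟩} →
      IsForcedLeft θ w t → IsForcedTop θ w t) ∧
    (∀ t : Tile n, t.labels =
        {w ⟨n - 2, Nat.sub_lt_of_pos_le two_pos hn⟩, w ⟨n - 1, Nat.sub_one_lt_of_lt hn⟩} →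
      IsForcedRight θ w t → IsForcedBottom θ w t) ∧
    (∀ t : Tile n, t.labels =
        {⟨n - 2, Nat.sub_lt_of_pos_le two_pos hn⟩, ⟨n - 1, Nat.sub_one_lt_of_lt hn⟩} →
      IsForcedLeft θ w t → IsForcedBottom θ w t) := by
  have hval : n - 1 = n - 2 + 1 := by omega
  have hlast : n - 1 + 1 = n := by omega
  refine ⟨fun t hl ht => ?_, fun t hl ht => ?_, fun t hl ht => ?_, fun t hl ht => ?_⟩
  · exact isForcedTop_of_forall_mem hθ rfl fun T hT => (ht T hT).imp_right fun h =>
      .inr (pathSide_mem_edges_of_labels_eq hθ rfl hl h).1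
  · exact isForcedTop_of_forall_mem hθ rfl fun T hT => (ht T hT).imp_right fun h =>
      .inl (pathSide_mem_edges_of_labels_eq (u := 1) hθ rfl hl h).1
  · exact isForcedBottom_of_forall_mem hθ hlast fun T hT => (ht T hT).imp_right fun h =>
      .inr (pathSide_mem_edges_of_labels_eq hθ hval hl h).2
  · exact isForcedBottom_of_forall_mem hθ hlast fun T hT => (ht T hT).imp_right fun h =>
      .inl (pathSide_mem_edges_of_labels_eq (u := 1) hθ hval hl h).2

theorem corollary4 (n : ℕ) (hn : 2 ≤ n) (w : Equiv.Perm (Fin n))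
    (hw : Elnitsky.FullySupported w) (θ : Fin n → ℝ) (hθ : Elnitsky.Admissible θ) :
    (∀ t : Elnitsky.Tile n, t.labels = {w ⟨0, by omega⟩, w ⟨1, by omega⟩} →
      Elnitsky.IsForcedRight θ w t → Elnitsky.IsForcedTop θ w t) ∧
    (∀ t : Elnitsky.Tile n, t.labels = {⟨0, by omega⟩, ⟨1, by omega⟩} →
      Elnitsky.IsForcedLeft θ w t → Elnitsky.IsForcedTop θ w t) ∧
    (∀ t : Elnitsky.Tile n, t.labels = {w ⟨n - 2, by omega⟩, w ⟨n - 1, by omega⟩} →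
      Elnitsky.IsForcedRight θ w t → Elnitsky.IsForcedBottom θ w t) ∧
    (∀ t : Elnitsky.Tile n, t.labels = {⟨n - 2, by omega⟩, ⟨n - 1, by omega⟩} →
      Elnitsky.IsForcedLeft θ w t → Elnitsky.IsForcedBottom θ w t) :=
  corollary4_general n hn w θ hθ
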